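/- **Setting.** Let $k$ be a field, and let $$\Sigma:\quad \dot\Theta=0,\qquad \dot X=F(X,\Theta,U),\qquad Y=G(X,\Theta,U)$$ be a system with $n\ge 1$ state variables $X$, $\ell$ parameters $\Theta$, $r$ inputs $U$ and $m\le n$ outputs $Y$, where $F$ and $G$ consist of rational fractions over $k$. The system is encoded by a straight-line program without division, with $L$ arithmetic operations, that computes the numerators and the denominators of $F$ and $G$. Let $P_i=\mathrm{den}(f_i)\,\dot x_i-\mathrm{num}(f_i)$ for $i=1,\dots,n$. Let $\mathcal L$ be the Lie derivation of $\Sigma$ (the derivation along $\dot X=F$, with $\mathcal L u^{(j)}=u^{(j+1)}$ for the inputs), and let $1\le \nu\le n+\ell$; the standard choice is $\nu=n+\ell$. **Multiplication algorithms.** Fix straight-line programs over $k$ (with operations $+,-,\times$) that multiply two power series modulo $t^{j+1}$ with $M(j)$ operations, for every $j\ge0$, and two $N\times N$ matrices over any commutative $k$-algebra with $\mathrm{Mat}(N)$ ring operations, for every $N$. Suppose that, for some constants $\kappa$ and $\varepsilon>0$, $$\frac{M(i)}{i+1}\le\kappa\,\frac{M(j)}{j+1}\quad(0\le i\le j),\qquad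 \frac{\mathrm{Mat}(i)}{i^{2+\varepsilon}}\le\kappa\,\frac{\mathrm{Mat}(j)}{j^{2+\varepsilon}}\quad(1\le i\le j).$$ **The local algebraic observability test.** The input is the encoding of $\Sigma$, the order $\nu$, and specializations $X_0\in k^n$, $\Theta\in k^\ell$, $U\in k[[t]]^r$ (chosen at random beforehand). 1. *Main loop.* Put $\Phi=X_0$, $\Gamma=\mathrm{Id}_{n\times n}$, $\Lambda=0_{n\times\ell}$. Let $q$ run through $2,4,8,\dots$ until $q$ reaches $\nu+1$ (the last value is replaced by $\nu+1$ if it is larger), and perform the last step twice. In each step, compute modulo $t^q$: * $\frac{\partial P}{\partial\dot X}$, $\frac{\partial P}{\partial X}$, $\frac{\partial P}{\partial\Theta}$ and $\nabla P=\big(P,\ \frac{\partial P}{\partial\dot X}\dot\Gamma+\frac{\partial P}{\partial X}\Gamma,\ \frac{\partial P}{\partial\dot X}\dot\Lambda+\frac{\partial P}{\partial X}\Lambda+\frac{\partial P}{\partial\Theta}\big)$ at the current $(\Phi,\Gamma,\Lambda)$, by evaluating the straight-line program on series and computing the gradients by the Baur–Strassen backward sweep; * the solution $W$ of $\frac{\partial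 P}{\partial\dot X}\dot W+\frac{\partial P}{\partial X}W=0$, $W(0)=\mathrm{Id}$, and $W^{-1}$, by the quadratic iteration $W\leftarrow W-W\int W^{-1}(\dot W+HW)$ with $H=(\frac{\partial P}{\partial\dot X})^{-1}\frac{\partial P}{\partial X}$, where $W^{-1}$ is updated by $V\leftarrow 2V-VWV$ (inverses of series are computed likewise); * by variation of constants, $E=-W\int W^{-1}\big(\frac{\partial P}{\partial\dot X}\big)^{-1}\nabla P\,dt$; then replace $(\Phi,\Gamma,\Lambda)$ by $(\Phi,\Gamma,\Lambda)+E$. 2. *Jacobian matrix.* Evaluate $\nabla Y=\big(\frac{\partial G}{\partial X}\Gamma,\ \frac{\partial G}{\partial X}\Lambda+\frac{\partial G}{\partial\Theta}\big)$ modulo $t^{\nu+1}$. Its coefficients form the $m(\nu+1)\times(n+\ell)$ specialized matrix $\partial(\mathcal L^jG)_{0\le j\le\nu}/\partial(X,\Theta)$, with the rows of order $j$ divided by $j!$. 3. *Ranks.* Compute the rank of this matrix and of the $n+\ell$ matrices obtained by deleting one column. Each rank is computed by recursive elimination with fast matrix multiplication: split the rows into two halves, find an invertible submatrix of maximal size in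 the first half, eliminate in the second half, recurse, and invert by blocks; a matrix with more rows than columns is transposed first. The test succeeds if the rank is $n+\ell$; otherwise it returns the defect $n+\ell-\mathrm{rank}$. A variable is declared observable if the rank drops when its column is deleted. All products of series and of matrices are performed by the given algorithms; matrices are padded with zeros to square ones, and matrices of series are multiplied by running the matrix multiplication program on truncated series. **Proposition.** There is a constant $C$, depending only on $\varepsilon$ and $\kappa$, such that for every such $k$, multiplication algorithms, $\Sigma$, $\nu$ and specialization, the number of operations in the base field $k$ (additions, subtractions, multiplications, divisions and tests for zero) used by this algorithm is at most $$C\left(M(\nu)\Big(\mathrm{Mat}(n+\ell)+(n+m)L\Big)+(n+\ell+1)\,\mathrm{Mat}(n+\ell)\,\frac{m\nu}{n+\ell}\right).$$ -/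

import Mathlib

namespace ObsTest

universe u v w

/-! ## Cost model: programs that count the operations of the base field

A program returns its result together with the number of base field operations that it has
performed on the given input.  Elements of the base field live in registers `Reg k`; no algebraic
structure is put on `Reg k`, and registers are read only by the five primitives `Reg.add`,
`Reg.sub`, `Reg.mul`, `Reg.div` and `Reg.ifZero`.  Each of them costs one operation.  Loading a
constant, copying, indexing and all work on natural numbers are free. -/

/-- A result with the number of base field operations spent to obtain it. -/
structure Counted (α : Type u) : Type u where
  result : α
  ops : ℕ

instance : Monad Counted where
  pure a := ⟨a, 0⟩
  bind x f := ⟨(f x.result).result, x.ops + (f x.result).ops⟩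

/-- The loop `for i < a`: the results in a table, the costs added up. -/
def forFin {α : Type u} {a : ℕ} (f : Fin a → Counted α) : Counted (Fin a → α) :=
  ⟨fun i => (f i).result, ∑ i, (f i).ops⟩

/-- The double loop `for i < a`, `for j < b`. -/
def forFin₂ {α : Type u} {a b : ℕ} (f : Fin a → Fin b → Counted α) :
    Counted (Fin a → Fin b → α) :=
  forFin fun i => forFin fun j => f i j

/-- The loop `for i < a`, with a table indexed by `ℕ` that holds `d` outside the loop. -/
def forNat {α : Type u} (d : α) (a : ℕ) (f : ℕ → Counted α) : Counted (ℕ → α) :=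
  ⟨fun i => if i < a then (f i).result else d, ∑ i ∈ Finset.range a, (f i).ops⟩

/-- The double loop `for i < a`, `for j < b`, with a table indexed by `ℕ × ℕ`. -/
def forNat₂ {α : Type u} (d : α) (a b : ℕ) (f : ℕ → ℕ → Counted α) : Counted (ℕ → ℕ → α) :=
  forNat (fun _ => d) a fun i => forNat d b (f i)

/-- A register that holds an element of the base field. -/
structure Reg (k : Type u) : Type u where
  val : k

section Registers

variable {k : Type u} [Field k]

def Reg.add (x y : Reg k) : Counted (Reg k) := ⟨⟨x.val + y.val⟩, 1⟩
def Reg.sub (x y : Reg k) : Counted (Reg k) := ⟨⟨x.val - y.val⟩, 1⟩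
def Reg.mul (x y : Reg k) : Counted (Reg k) := ⟨⟨x.val * y.val⟩, 1⟩
def Reg.div (x y : Reg k) : Counted (Reg k) := ⟨⟨x.val / y.val⟩, 1⟩

/-- Branching on a test for zero. -/
def Reg.ifZero [DecidableEq k] {α : Type u} (x : Reg k) (yes no : Counted α) : Counted α :=
  if x.val = 0 then ⟨yes.result, yes.ops + 1⟩ else ⟨no.result, no.ops + 1⟩

end Registers

/-! ## Straight-line programs without division -/

inductive RingOp : Type
  | add
  | sub
  | mul

/-- An operand of an instruction: a variable, a constant or the result of one of the `L`
instructions that come before. -/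
inductive Operand (k : Type u) (σ : Type) (L : ℕ) : Type u
  | var (x : σ)
  | const (c : k)
  | reg (i : Fin L)

/-- A division-free straight-line program with `L` instructions, over the variables `σ` and with
constants in `k`. -/
inductive SLP (k : Type u) (σ : Type) : ℕ → Type u
  | nil : SLP k σ 0
  | snoc {L : ℕ} (p : SLP k σ L) (op : RingOp) (a b : Operand k σ L) : SLP k σ (L + 1)

/-- The value of an operand, from the values `x` of the variables and `v` of the instructions. -/
def Operand.read {k : Type u} {σ : Type} {L : ℕ} {α : Type v} (ι : k → α) (x : σ → α)
    (v : Fin L → α) : Operand k σ L → α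
  | .var s => x s
  | .const c => ι c
  | .reg i => v i

def RingOp.apply {A : Type v} [CommRing A] : RingOp → A → A → A
  | .add, a, b => a + b
  | .sub, a, b => a - b
  | .mul, a, b => a * b

/-- The mathematical value of the instructions, in any commutative `k`-algebra. -/
def SLP.eval {k : Type u} [Field k] {σ : Type} {A : Type v} [CommRing A] [Algebra k A]
    (x : σ → A) : {L : ℕ} → SLP k σ L → Fin L → A
  | _, .nil => Fin.elim0
  | _, .snoc p op a b =>
    let val := p.eval x
    Fin.snoc (α := fun _ => A) val
      (op.apply (a.read (algebraMap k A) x val) (b.read (algebraMap k A) x val))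

/-- The polynomial that a straight-line program computes in the operand `o`. -/
noncomputable def SLP.poly {k : Type u} [Field k] {σ : Type} {L : ℕ} (p : SLP k σ L)
    (o : Operand k σ L) : MvPolynomial σ k :=
  o.read (algebraMap k (MvPolynomial σ k)) MvPolynomial.X (p.eval MvPolynomial.X)

/-- Counted ring operations on a type `α` of data. -/
structure Arith (k : Type u) (α : Type u) : Type u where
  const : k → α
  add : α → α → Counted α
  sub : α → α → Counted α
  mul : α → α → Counted α

def RingOp.exec {k α : Type u} (R : Arith k α) : RingOp → α → α → Counted α
  | .add => R.add
  | .sub => R.sub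
  | .mul => R.mul

/-- Execution of a straight-line program on data of type `α`. -/
def SLP.run {k α : Type u} {σ : Type} (R : Arith k α) (x : σ → α) :
    {L : ℕ} → SLP k σ L → Counted (Fin L → α)
  | _, .nil => pure Fin.elim0
  | _, .snoc p op a b => do
    let val ← p.run R x
    let y ← op.exec R (a.read R.const x val) (b.read R.const x val)
    pure (Fin.snoc (α := fun _ => α) val y)

/-- Adjoints of the variables and of the instructions. -/
structure Adjoints (σ : Type) (L : ℕ) (α : Type u) : Type u where
  var : σ → α
  reg : Fin L → α

/-- Combine (by `f`) the adjoint of the operand `o` with `d`. -/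
def Operand.accumulate {k α : Type u} {σ : Type} [DecidableEq σ] {L : ℕ}
    (f : α → α → Counted α) (o : Operand k σ L) (d : α) (g : Adjoints σ L α) :
    Counted (Adjoints σ L α) :=
  match o with
  | .var s => do
    let y ← f (g.var s) d
    pure ⟨Function.update g.var s y, g.reg⟩
  | .const _ => pure g
  | .reg i => do
    let y ← f (g.reg i) d
    pure ⟨g.var, Function.update g.reg i y⟩

/-- The backward sweep of the Baur-Strassen method: at most four operations per instruction. -/
def SLP.backward {k α : Type u} {σ : Type} [DecidableEq σ] (R : Arith k α) (x : σ → α) :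
    {L : ℕ} → SLP k σ L → (Fin L → α) → Adjoints σ L α → Counted (σ → α)
  | _, .nil, _, g => pure g.var
  | _, .snoc p op a b, val, g => do
    let d := g.reg (Fin.last _)
    let val₀ := Fin.init (α := fun _ => α) val
    let g₀ : Adjoints σ _ α := ⟨g.var, Fin.init (α := fun _ => α) g.reg⟩
    match op with
    | .add => do
      let g₁ ← a.accumulate R.add d g₀
      let g₂ ← b.accumulate R.add d g₁
      p.backward R x val₀ g₂
    | .sub => do
      let g₁ ← a.accumulate R.add d g₀
      let g₂ ← b.accumulate R.sub d g₁
      p.backward R x val₀ g₂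
    | .mul => do
      let da ← R.mul d (b.read R.const x val₀)
      let db ← R.mul d (a.read R.const x val₀)
      let g₁ ← a.accumulate R.add da g₀
      let g₂ ← b.accumulate R.add db g₁
      p.backward R x val₀ g₂

/-- The vector of `c₁ * ∂o₁/∂s + c₂ * ∂o₂/∂s`, for all variables `s`, where `o₁` and `o₂` are
operands of `p` and `val` holds the values of its instructions (Baur-Strassen). -/
def SLP.gradient {k α : Type u} [Field k] {σ : Type} [DecidableEq σ] {L : ℕ} (R : Arith k α)
    (x : σ → α) (p : SLP k σ L) (val : Fin L → α) (o₁ : Operand k σ L) (c₁ : α)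
    (o₂ : Operand k σ L) (c₂ : α) : Counted (σ → α) := do
  let g₁ ← o₁.accumulate R.add c₁ ⟨fun _ => R.const 0, fun _ => R.const 0⟩
  let g₂ ← o₂.accumulate R.add c₂ g₁
  p.backward R x val g₂

/-! ## The multiplication algorithms that the test is built on -/

/-- An algorithm for the multiplication of two series at order `j + 1`, that is modulo
`t ^ (j + 1)`, for every `j`, with `M j` operations. -/
structure SeriesMultiplication (k : Type u) [Field k] : Type u where
  M : ℕ → ℕ
  prog : ∀ j, SLP k (Fin (j + 1) ⊕ Fin (j + 1)) (M j)
  out : ∀ j, Fin (j + 1) → Operand k (Fin (j + 1) ⊕ Fin (j + 1)) (M j)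
  correct : ∀ (j : ℕ) (i : Fin (j + 1)), (prog j).poly (out j i) =
    ∑ a : Fin (j + 1), ∑ b : Fin (j + 1), if (a : ℕ) + (b : ℕ) = (i : ℕ) then
      MvPolynomial.X (Sum.inl a) * MvPolynomial.X (Sum.inr b) else 0

/-- An algorithm for the multiplication of two `N × N` matrices over any commutative `k`-algebra,
for every `N`, with `Mat N` ring operations. -/
structure MatrixMultiplication (k : Type u) [Field k] : Type u where
  Mat : ℕ → ℕ
  prog : ∀ N, SLP k ((Fin N × Fin N) ⊕ (Fin N × Fin N)) (Mat N)
  out : ∀ N, Fin N → Fin N → Operand k ((Fin N × Fin N) ⊕ (Fin N × Fin N)) (Mat N)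
  correct : ∀ (N : ℕ) (i j : Fin N), (prog N).poly (out N i j) =
    ∑ l : Fin N, MvPolynomial.X (Sum.inl (i, l)) * MvPolynomial.X (Sum.inr (l, j))

/-- Multiplication of series grows at least linearly, up to the factor `κ`. -/
def SeriesMultiplication.Regular {k : Type u} [Field k] (S : SeriesMultiplication k)
    (κ : ℝ) : Prop :=
  ∀ i j : ℕ, i ≤ j → (S.M i : ℝ) / (i + 1) ≤ κ * ((S.M j : ℝ) / (j + 1))

/-- Multiplication of matrices grows at least like the power `2 + ε`, up to the factor `κ`. -/
def MatrixMultiplication.Regular {k : Type u} [Field k] (T : MatrixMultiplication k)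
    (ε κ : ℝ) : Prop :=
  ∀ i j : ℕ, 1 ≤ i → i ≤ j →
    (T.Mat i : ℝ) / (i : ℝ) ^ (2 + ε) ≤ κ * ((T.Mat j : ℝ) / (j : ℝ) ^ (2 + ε))

/-! ## Truncated power series -/

/-- The coefficients of a power series.  An operation "at order `j`" computes modulo
`t ^ (j + 1)`, and its result is filled up with zeros. -/
abbrev Ser (k : Type u) : Type u := ℕ → Reg k

section Algorithms

variable {k : Type u} [Field k]

def regArith : Arith k (Reg k) := ⟨Reg.mk, Reg.add, Reg.sub, Reg.mul⟩

def Ser.ofReg (c : Reg k) : Ser k := fun i => if i = 0 then c else ⟨0⟩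

def Ser.const (c : k) : Ser k := Ser.ofReg ⟨c⟩

def Ser.add (j : ℕ) (a b : Ser k) : Counted (Ser k) :=
  forNat ⟨0⟩ (j + 1) fun i => (a i).add (b i)

def Ser.sub (j : ℕ) (a b : Ser k) : Counted (Ser k) :=
  forNat ⟨0⟩ (j + 1) fun i => (a i).sub (b i)

def Ser.mul (S : SeriesMultiplication k) (j : ℕ) (a b : Ser k) : Counted (Ser k) := do
  let x : Fin (j + 1) ⊕ Fin (j + 1) → Reg k := Sum.elim (fun i => a i) (fun i => b i)
  let val ← (S.prog j).run regArith x
  pure fun i => if h : i < j + 1 then (S.out j ⟨i, h⟩).read Reg.mk x val else ⟨0⟩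

def serArith (S : SeriesMultiplication k) (j : ℕ) : Arith k (Ser k) :=
  ⟨Ser.const, Ser.add j, Ser.sub j, Ser.mul S j⟩

/-- The derivative with respect to `t`. -/
def Ser.deriv (j : ℕ) (a : Ser k) : Counted (Ser k) :=
  forNat ⟨0⟩ (j + 1) fun i => Reg.mul ⟨((i + 1 : ℕ) : k)⟩ (a (i + 1))

/-- The primitive without constant term. -/
def Ser.integral (j : ℕ) (a : Ser k) : Counted (Ser k) :=
  forNat ⟨0⟩ (j + 1) fun i => if i = 0 then pure ⟨0⟩ else Reg.div (a (i - 1)) ⟨(i : k)⟩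

/-- Quadratic iteration: from order `j` on, the number `j + 1` of correct coefficients is doubled
until the order `N` is reached; `step q` is the computation at order `q`. -/
def newtonLoop {α : Type u} (step : ℕ → α → Counted α) (N j : ℕ) (s : α) : Counted α :=
  if j < N then do
    let s' ← step (min (2 * j + 1) N) s
    newtonLoop step N (min (2 * j + 1) N) s'
  else pure s
termination_by N - j
decreasing_by omega

/-- The inverse of a series, by the iteration `b ← 2 b - b a b`. -/
def Ser.inv (S : SeriesMultiplication k) (N : ℕ) (a : Ser k) : Counted (Ser k) := do
  let b₀ ← Reg.div ⟨1⟩ (a 0)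
  newtonLoop (fun q b => do
    let ab ← Ser.mul S q a b
    let bab ← Ser.mul S q b ab
    let bb ← Ser.add q b b
    Ser.sub q bb bab) N 0 (Ser.ofReg b₀)

/-! ## Matrices -/

/-- A table with entries in `α`; the dimensions of the matrix are given separately. -/
abbrev Table (α : Type u) : Type u := ℕ → ℕ → α

/-- The product of the upper left `N × N` blocks. -/
def Table.mul {α : Type u} (R : Arith k α) (T : MatrixMultiplication k) (N : ℕ)
    (A B : Table α) : Counted (Table α) := do
  let x : (Fin N × Fin N) ⊕ (Fin N × Fin N) → α :=
    Sum.elim (fun p => A p.1 p.2) (fun p => B p.1 p.2)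
  let val ← (T.prog N).run R x
  pure fun i j => if h : i < N ∧ j < N then
    (T.out N ⟨i, h.1⟩ ⟨j, h.2⟩).read R.const x val else R.const 0

/-- An `a × b` matrix of series, filled up with zeros. -/
def Table.pad {a b : ℕ} (A : Fin a → Fin b → Ser k) : Table (Ser k) := fun i j =>
  if h : i < a ∧ j < b then A ⟨i, h.1⟩ ⟨j, h.2⟩ else Ser.const 0

/-- The product of an `a × b` and a `b × c` matrix of series at order `j`, with `a, b, c ≤ N`: the
matrices are filled up with zeros to `N × N` matrices. -/
def matMul (S : SeriesMultiplication k) (T : MatrixMultiplication k) (N j : ℕ) {a b c : ℕ}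
    (A : Fin a → Fin b → Ser k) (B : Fin b → Fin c → Ser k) :
    Counted (Fin a → Fin c → Ser k) := do
  let P ← Table.mul (serArith S j) T N (Table.pad A) (Table.pad B)
  pure fun i l => P i l

def identity (k : Type u) [Field k] (n : ℕ) : Fin n → Fin n → Ser k := fun i l =>
  if i = l then Ser.const 1 else Ser.const 0

/-! ## The state-space system and its variational system -/

/-- The state variables, the parameters and the inputs. -/
abbrev Var (n l r : ℕ) : Type := Fin n ⊕ Fin l ⊕ Fin r

/-- A system `Θ' = 0`, `X' = F(X,Θ,U)`, `Y = G(X,Θ,U)` with `n` state variables, `l` parameters,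
`r` inputs and `m` outputs, encoded by a division-free straight-line program with `L` instructions
for the numerators and the denominators of the rational fractions `F` and `G`. -/
structure StateSpaceSystem (k : Type u) [Field k] (n l r m L : ℕ) : Type u where
  prog : SLP k (Var n l r) L
  fNum : Fin n → Operand k (Var n l r) L
  fDen : Fin n → Operand k (Var n l r) L
  gNum : Fin m → Operand k (Var n l r) L
  gDen : Fin m → Operand k (Var n l r) L
  fDen_ne_zero : ∀ i, prog.poly (fDen i) ≠ 0
  gDen_ne_zero : ∀ i, prog.poly (gDen i) ≠ 0

/-- Specialized parameters (constants), inputs (power series in `t`) and initial conditions. -/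
structure Specialization (k : Type u) (n l r : ℕ) : Type u where
  X₀ : Fin n → k
  Θ : Fin l → k
  U : Fin r → ℕ → k

/-- Approximations of `Φ`, of `Γ = ∂Φ/∂X` and of `Λ = ∂Φ/∂Θ`. -/
structure Approx (k : Type u) (n l : ℕ) : Type u where
  Φ : Fin n → Ser k
  Γ : Fin n → Fin n → Ser k
  Λ : Fin n → Fin l → Ser k

/-- The point `(Φ, Θ, U)` at which the straight-line programs are evaluated. -/
def Specialization.env {n l r : ℕ} (z : Specialization k n l r) (Φ : Fin n → Ser k) :
    Var n l r → Ser k :=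
  Sum.elim Φ (Sum.elim (fun i => Ser.const (z.Θ i)) (fun i d => ⟨z.U i d⟩))

/-- The values of `P_i = den(f_i) * x_i' - num(f_i)` and of its partial derivatives, and of the
linear variational system.  Here `∂P/∂X'` is the diagonal matrix with entries `Pdx`. -/
structure Variational (k : Type u) (n l : ℕ) : Type u where
  Pdx : Fin n → Ser k
  Px : Fin n → Fin n → Ser k
  P : Fin n → Ser k
  PΓ : Fin n → Fin n → Ser k
  PΛ : Fin n → Fin l → Ser k

/-- Evaluation of `∂P/∂X'`, `∂P/∂X` and of
`∇P = (P, ∂P/∂X' Γ' + ∂P/∂X Γ, ∂P/∂X' Λ' + ∂P/∂X Λ + ∂P/∂Θ)` at order `j`. -/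
def evalVariational (S : SeriesMultiplication k) (T : MatrixMultiplication k) {n l r m L : ℕ}
    (sys : StateSpaceSystem k n l r m L) (z : Specialization k n l r) (j : ℕ)
    (s : Approx k n l) : Counted (Variational k n l) := do
  let R := serArith S j
  let x := z.env s.Φ
  let val ← sys.prog.run R x
  let den : Fin n → Ser k := fun i => (sys.fDen i).read R.const x val
  let num : Fin n → Ser k := fun i => (sys.fNum i).read R.const x val
  let dΦ ← forFin fun i => Ser.deriv j (s.Φ i)
  let P ← forFin fun i => do
    let y ← Ser.mul S j (den i) (dΦ i)
    Ser.sub j y (num i)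
  let grad ← forFin fun i =>
    sys.prog.gradient R x val (sys.fDen i) (dΦ i) (sys.fNum i) (Ser.const (-1))
  let Px : Fin n → Fin n → Ser k := fun i a => grad i (Sum.inl a)
  let Pθ : Fin n → Fin l → Ser k := fun i a => grad i (Sum.inr (Sum.inl a))
  let PxΓ ← matMul S T (n + l) j Px s.Γ
  let PΓ ← forFin₂ fun i a => do
    let y ← Ser.deriv j (s.Γ i a)
    let y ← Ser.mul S j (den i) y
    Ser.add j y (PxΓ i a)
  let PxΛ ← matMul S T (n + l) j Px s.Λ
  let PΛ ← forFin₂ fun i a => do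
    let y ← Ser.deriv j (s.Λ i a)
    let y ← Ser.mul S j (den i) y
    let y ← Ser.add j y (PxΛ i a)
    Ser.add j y (Pθ i a)
  pure ⟨den, Px, P, PΓ, PΛ⟩

/-- A fundamental matrix `W` of a homogeneous linear differential system, and its inverse `V`. -/
structure Fundamental (k : Type u) (n : ℕ) : Type u where
  W : Fin n → Fin n → Ser k
  V : Fin n → Fin n → Ser k

/-- The solution `W` of `W' + H W = 0`, `W(0) = Id`, at order `N`, with its inverse `V`, by the
quadratic iteration `W ← W - W ∫ V (W' + H W)`, `V ← 2 V - V W V`. -/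
def homogeneousResolution (S : SeriesMultiplication k) (T : MatrixMultiplication k) (size : ℕ)
    {n : ℕ} (N : ℕ) (H : Fin n → Fin n → Ser k) : Counted (Fundamental k n) :=
  newtonLoop (fun q s => do
    let HW ← matMul S T size q H s.W
    let D ← forFin₂ fun i a => do
      let y ← Ser.deriv q (s.W i a)
      Ser.add q y (HW i a)
    let VD ← matMul S T size q s.V D
    let I ← forFin₂ fun i a => Ser.integral q (VD i a)
    let WI ← matMul S T size q s.W I
    let W ← forFin₂ fun i a => Ser.sub q (s.W i a) (WI i a)
    let WV ← matMul S T size q W s.V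
    let VWV ← matMul S T size q s.V WV
    let V ← forFin₂ fun i a => do
      let y ← Ser.add q (s.V i a) (s.V i a)
      Ser.sub q y (VWV i a)
    pure ⟨W, V⟩) N 0 ⟨identity k n, identity k n⟩

/-- Variation of constants: the matrix `W ∫ V A⁻¹ Q`, where `A⁻¹` is diagonal with entries
`Ainv`; its opposite is the solution `E` of `A E' + B E + Q = 0` with `E(0) = 0`, if `W` is the
fundamental matrix for `H = A⁻¹ B` and `V` its inverse. -/
def constantsVariation (S : SeriesMultiplication k) (T : MatrixMultiplication k) (size : ℕ)
    {n c : ℕ} (j : ℕ) (Ainv : Fin n → Ser k) (F : Fundamental k n)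
    (Q : Fin n → Fin c → Ser k) : Counted (Fin n → Fin c → Ser k) := do
  let AQ ← forFin₂ fun i a => Ser.mul S j (Ainv i) (Q i a)
  let VAQ ← matMul S T size j F.V AQ
  let I ← forFin₂ fun i a => Ser.integral j (VAQ i a)
  matMul S T size j F.W I

/-- One step of the quadratic Newton operator, at order `j`. -/
def newtonStep (S : SeriesMultiplication k) (T : MatrixMultiplication k) {n l r m L : ℕ}
    (sys : StateSpaceSystem k n l r m L) (z : Specialization k n l r) (j : ℕ)
    (s : Approx k n l) : Counted (Approx k n l) := do
  let p ← evalVariational S T sys z j s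
  let Ainv ← forFin fun i => Ser.inv S j (p.Pdx i)
  let H ← forFin₂ fun i a => Ser.mul S j (Ainv i) (p.Px i a)
  let F ← homogeneousResolution S T (n + l) j H
  let EΦ ← constantsVariation S T (n + l) j Ainv F fun i (_ : Fin 1) => p.P i
  let EΓ ← constantsVariation S T (n + l) j Ainv F p.PΓ
  let EΛ ← constantsVariation S T (n + l) j Ainv F p.PΛ
  let Φ ← forFin fun i => Ser.sub j (s.Φ i) (EΦ i 0)
  let Γ ← forFin₂ fun i a => Ser.sub j (s.Γ i a) (EΓ i a)
  let Λ ← forFin₂ fun i a => Ser.sub j (s.Λ i a) (EΛ i a)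
  pure ⟨Φ, Γ, Λ⟩

/-- The initial conditions `Φ(0) = X₀`, `Γ(0) = Id`, `Λ(0) = 0`. -/
def Specialization.start {n l r : ℕ} (z : Specialization k n l r) : Approx k n l :=
  ⟨fun i => Ser.const (z.X₀ i), identity k n, fun _ _ => Ser.const 0⟩

/-- The main loop.  The linear part of the variational system is solved along the approximation of
`Φ` from the preceding step, so `Γ` and `Λ` are behind `Φ` by one step; hence the last step is
repeated once at the same order. -/
def solveVariational (S : SeriesMultiplication k) (T : MatrixMultiplication k) {n l r m L : ℕ}
    (sys : StateSpaceSystem k n l r m L) (z : Specialization k n l r) (ν : ℕ) :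
    Counted (Approx k n l) := do
  let s ← newtonLoop (newtonStep S T sys z) ν 0 z.start
  newtonStep S T sys z ν s

/-- Evaluation of `∇Y = (∂G/∂X Γ, ∂G/∂X Λ + ∂G/∂Θ)` at order `j`; the gradient of
`g = num / den` is `(1 / den) ∇num - (g / den) ∇den`. -/
def evalOutput (S : SeriesMultiplication k) (T : MatrixMultiplication k) {n l r m L : ℕ}
    (sys : StateSpaceSystem k n l r m L) (z : Specialization k n l r) (j : ℕ)
    (s : Approx k n l) : Counted (Fin m → Fin (n + l) → Ser k) := do
  let R := serArith S j
  let x := z.env s.Φ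
  let val ← sys.prog.run R x
  let grad ← forFin fun i => do
    let inv ← Ser.inv S j ((sys.gDen i).read R.const x val)
    let y ← Ser.mul S j ((sys.gNum i).read R.const x val) inv
    let y ← Ser.mul S j y inv
    let y ← Ser.sub j (Ser.const 0) y
    sys.prog.gradient R x val (sys.gNum i) inv (sys.gDen i) y
  let Gx : Fin m → Fin n → Ser k := fun i a => grad i (Sum.inl a)
  let Gθ : Fin m → Fin l → Ser k := fun i a => grad i (Sum.inr (Sum.inl a))
  let GΓ ← matMul S T (n + l) j Gx s.Γ
  let GΛ ← matMul S T (n + l) j Gx s.Λ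
  let YΛ ← forFin₂ fun i a => Ser.add j (GΛ i a) (Gθ i a)
  pure fun i => Fin.append (GΓ i) (YΛ i)

/-- The coefficients of `t ^ d`, `d = 0, …, ν`, of `∇Y`: a matrix with `m (ν + 1)` rows and `n + l`
columns.  The row `i (ν + 1) + d` is the gradient with respect to `(X, Θ)` of the `d`-th Taylor
coefficient of the output `y_i` (the `d`-th Lie derivative of `g_i`, divided by `d!`). -/
def coeffs {m c : ℕ} (ν : ℕ) (Y : Fin m → Fin c → Ser k) : Table (Reg k) := fun row a =>
  if h : row / (ν + 1) < m ∧ a < c then Y ⟨row / (ν + 1), h.1⟩ ⟨a, h.2⟩ (row % (ν + 1)) else ⟨0⟩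

/-! ## Rank computation through matrix multiplication -/

/-- Positions `rows`, `cols` of a maximal invertible square submatrix, and its inverse. -/
structure Pivots (k : Type u) : Type u where
  rows : List ℕ
  cols : List ℕ
  inv : Table (Reg k)

def Pivots.rank (p : Pivots k) : ℕ := p.cols.length

/-- The upper left `a × b` block, filled up with zeros. -/
def Table.block (a b : ℕ) (A : Table (Reg k)) : Table (Reg k) := fun i j =>
  if i < a ∧ j < b then A i j else ⟨0⟩

/-- The product of an `N × N` matrix and a matrix with `b` columns, in slices of `N` columns. -/
def Table.mulWide (T : MatrixMultiplication k) (N b : ℕ) (A B : Table (Reg k)) :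
    Counted (Table (Reg k)) := do
  let slices ← forNat (fun _ _ => ⟨0⟩) ((b + N - 1) / N) fun e =>
    Table.mul regArith T N A fun i j => if e * N + j < b then B i (e * N + j) else ⟨0⟩
  pure fun i j => slices (j / N) i (j % N)

/-- The first nonzero entry of a row at the `t` columns from `c` on. -/
def firstPivot [DecidableEq k] (x : ℕ → Reg k) : ℕ → ℕ → Counted (Pivots k)
  | 0, _ => pure ⟨[], [], fun _ _ => ⟨0⟩⟩
  | t + 1, c => (x c).ifZero (firstPivot x t (c + 1)) do
      let y ← Reg.div ⟨1⟩ (x c)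
      pure ⟨[0], [c], fun _ _ => y⟩

/-- A maximal invertible submatrix of the `a × b` matrix `A`, by division of the rows into two
halves `A₁`, `A₂`: with an invertible submatrix for `A₁`, one eliminates in `A₂`, goes on with
the result and inverts the submatrix that is composed of both by blocks. -/
def pivots [DecidableEq k] (T : MatrixMultiplication k) (b : ℕ) :
    ℕ → Table (Reg k) → Counted (Pivots k)
  | 0, _ => pure ⟨[], [], fun _ _ => ⟨0⟩⟩
  | 1, A => firstPivot (A 0) b 0
  | a + 2, A => do
    let h := (a + 2) / 2
    let N := (a + 2) - (a + 2) / 2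
    let p ← pivots T b ((a + 2) / 2) A
    let r := p.rank
    let row₁ : ℕ → ℕ := fun i => p.rows.getD i 0
    let col₁ : ℕ → ℕ := fun j => p.cols.getD j 0
    let K₁ := Table.block r r p.inv
    -- the rows of the second half, reduced by the pivot rows of the first half
    let F ← Table.mul regArith T N (Table.block N r fun i j => A (h + i) (col₁ j)) K₁
    let G ← Table.mulWide T N b F (Table.block r b fun i j => A (row₁ i) j)
    let A₂ ← forNat₂ ⟨0⟩ N b fun i j => (A (h + i) j).sub (G i j)
    let q ← pivots T b ((a + 2) - (a + 2) / 2) A₂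
    let r' := q.rank
    let row₂ : ℕ → ℕ := fun i => q.rows.getD i 0
    let col₂ : ℕ → ℕ := fun j => q.cols.getD j 0
    let K₂ := Table.block r' r' q.inv
    -- the inverse of the submatrix composed of both, by blocks
    let K₁Q ← Table.mul regArith T N K₁ (Table.block r r' fun i j => A (row₁ i) (col₂ j))
    let B ← Table.mul regArith T N K₁Q K₂
    let RK₁ := Table.block r' r fun i j => F (row₂ i) j
    let C ← Table.mul regArith T N K₂ RK₁
    let D ← Table.mul regArith T N B RK₁
    let I₁₁ ← forNat₂ ⟨0⟩ r r fun i j => (K₁ i j).add (D i j)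
    let I₁₂ ← forNat₂ ⟨0⟩ r r' fun i j => Reg.sub ⟨0⟩ (B i j)
    let I₂₁ ← forNat₂ ⟨0⟩ r' r fun i j => Reg.sub ⟨0⟩ (C i j)
    pure ⟨p.rows ++ q.rows.map (h + ·), p.cols ++ q.cols, fun i j =>
      if i < r then (if j < r then I₁₁ i j else I₁₂ i (j - r))
      else (if j < r then I₂₁ (i - r) j else K₂ (i - r) (j - r))⟩
termination_by a => a

/-- Rank computation for an `a × b` matrix; it is transposed if it has more rows than columns. -/
def rankComputation [DecidableEq k] (T : MatrixMultiplication k) (a b : ℕ) (A : Table (Reg k)) :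
    Counted (Pivots k) :=
  if a ≤ b then pivots T b a A else pivots T a b fun i j => A j i

/-! ## The local algebraic observability test -/

/-- The output of the test: whether the system is observable, the number of variables that have
to be assumed known in order to obtain an observable system, the observability of each of the
variables in `(X, Θ)`, and the specialized jacobian matrix. -/
structure Report (k : Type u) (n l : ℕ) : Type u where
  succeed : Bool
  defect : ℕ
  observable : Fin (n + l) → Bool
  jacobian : Table (Reg k)

/-- The test, with the jacobian matrix of the Lie derivatives of the outputs up to the order `ν`.
A variable is declared observable if the rank drops when its column is removed. -/
def observabilityTest [DecidableEq k] (S : SeriesMultiplication k) (T : MatrixMultiplication k)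
    {n l r m L : ℕ} (sys : StateSpaceSystem k n l r m L) (z : Specialization k n l r) (ν : ℕ) :
    Counted (Report k n l) := do
  let s ← solveVariational S T sys z ν
  let Y ← evalOutput S T sys z ν s
  let J := coeffs ν Y
  let full ← rankComputation T (m * (ν + 1)) (n + l) J
  let sub ← forFin fun c : Fin (n + l) => rankComputation T (m * (ν + 1)) (n + l - 1)
    fun i a => J i (if a < (c : ℕ) then a else a + 1)
  pure {
    succeed := decide (full.rank = n + l)
    defect := n + l - full.rank
    observable := fun c => decide ((sub c).rank < full.rank)
    jacobian := J }

end Algorithms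

end ObsTest

namespace ObsTest

universe u

/-! ## Costs of composed programs -/

section Cost

variable {α β : Type u}

/-! The cost is bounded compositionally, and three facts turn the resulting sums into the stated
form.

Multiplication dominates all linear work. A correct multiplication program has pairwise different
instructions for its quadratic outputs (`SLP.card_le_length`), so `M(j) ≥ j + 1` and `Mat(N) ≥ N²`.
Additions, derivatives, integrals and entrywise loops over matrices are therefore absorbed by
products of series and of matrices.

Quadratic iteration costs a constant times its last step (`newtonLoop_ops_le`). The numbers of
coefficients grow geometrically, and regularity of `M` compares each step with the last. This
applies to inversion of series, to the fundamental matrix and to the main loop. The system itself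
contributes `O(n + m)` gradients, each costing `O(L)` series operations by Baur–Strassen whatever
the number of variables.

Recursive elimination loses no logarithm (`pivots_ops_le`). One level on `a` rows and `b` columns
costs `O(K b a ^ (1 + ε))` when `Mat(i) ≤ K i ^ (2 + ε)`. The two halves together have at most
`(2/3) ^ ε` times the weight `a ^ (1 + ε)`, so the recurrence sums like a geometric series.
Regularity of `Mat` supplies `K` from the reference size `N = n + l`, giving `O(Mat(N) a b / N²)`
whenever the smaller dimension is at most `N`; this is applied to `n + l + 1` matrices. -/

@[simp] theorem Counted.ops_pure (a : α) : (pure a : Counted α).ops = 0 := rfl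

@[simp] theorem Counted.result_pure (a : α) : (pure a : Counted α).result = a := rfl

@[simp] theorem Counted.ops_bind (x : Counted α) (f : α → Counted β) :
    (x >>= f).ops = x.ops + (f x.result).ops := rfl

@[simp] theorem Counted.result_bind (x : Counted α) (f : α → Counted β) :
    (x >>= f).result = (f x.result).result := rfl

/-- Nested applications mirror a `do` block: unification assembles the bound as a sum, which one
final inequality then simplifies. The continuation needs a bound only at the result actually
obtained. -/
theorem Counted.ops_bind_le {x : Counted α} {f : α → Counted β} {p q : ℝ}
    (hx : (x.ops : ℝ) ≤ p) (hf : ((f x.result).ops : ℝ) ≤ q) :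
    ((x >>= f).ops : ℝ) ≤ p + q := by
  rw [Counted.ops_bind, Nat.cast_add]
  exact add_le_add hx hf

theorem Counted.ops_pure_le (a : α) : ((pure a : Counted α).ops : ℝ) ≤ 0 := by simp

theorem forFin_ops_le {a : ℕ} {f : Fin a → Counted α} {c : ℝ}
    (h : ∀ i, ((f i).ops : ℝ) ≤ c) : ((forFin f).ops : ℝ) ≤ a * c := by
  simp only [forFin, Nat.cast_sum]
  calc ∑ i, ((f i).ops : ℝ) ≤ ∑ _i : Fin a, c := Finset.sum_le_sum fun i _ => h i
    _ = a * c := by simp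

theorem forFin₂_ops_le {a b : ℕ} {f : Fin a → Fin b → Counted α} {c : ℝ}
    (h : ∀ i j, ((f i j).ops : ℝ) ≤ c) : ((forFin₂ f).ops : ℝ) ≤ a * (b * c) :=
  forFin_ops_le fun i => forFin_ops_le (h i)

theorem forNat_ops_le {d : α} {a : ℕ} {f : ℕ → Counted α} {c : ℝ}
    (h : ∀ i, ((f i).ops : ℝ) ≤ c) : ((forNat d a f).ops : ℝ) ≤ a * c := by
  simp only [forNat, Nat.cast_sum]
  calc ∑ i ∈ Finset.range a, ((f i).ops : ℝ) ≤ ∑ _i ∈ Finset.range a, c :=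
        Finset.sum_le_sum fun i _ => h i
    _ = a * c := by simp

theorem forNat₂_ops_le {d : α} {a b : ℕ} {f : ℕ → ℕ → Counted α} {c : ℝ}
    (h : ∀ i j, ((f i j).ops : ℝ) ≤ c) : ((forNat₂ d a b f).ops : ℝ) ≤ a * (b * c) :=
  forNat_ops_le fun i => forNat_ops_le (h i)

/-- The orders that the quadratic iteration runs through add up to at most three times the
last one. -/
theorem newtonLoop_ops_le_of_le (step : ℕ → α → Counted α) (N : ℕ) {B : ℝ} (hB : 0 ≤ B)
    (h : ∀ q ≤ N, ∀ s, ((step q s).ops : ℝ) ≤ B * (q + 1)) (j : ℕ) (hj : j ≤ N) (s : α) :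
    ((newtonLoop step N j s).ops : ℝ) ≤ B * (3 * (N + 1) - 2 * (j + 1)) := by
  have hjN : (j : ℝ) ≤ N := by exact_mod_cast hj
  rw [newtonLoop]
  split_ifs with hlt
  · rcases le_total (2 * j + 1) N with h' | h'
    · rw [min_eq_left h']
      refine le_trans (Counted.ops_bind_le (h _ h' s)
        (newtonLoop_ops_le_of_le step N hB h _ h' _)) ?_
      -- The potential is tight here: `2 (j + 1) + (3 (N + 1) - 2 (2 j + 2)) = 3 (N + 1) - 2 (j +
      -- 1)`.
      rw [← mul_add]
      refine mul_le_mul_of_nonneg_left ?_ hB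
      push_cast
      linarith
    · rw [min_eq_right h']
      refine le_trans (Counted.ops_bind_le (q := 0) (h _ le_rfl s) ?_) ?_
      -- The capped step is the last one, and `N + 1` coefficients fit into the potential because `j
      -- ≤ N`.
      · rw [newtonLoop, if_neg (lt_irrefl _), Counted.ops_pure, Nat.cast_zero]
      · rw [add_zero]
        exact mul_le_mul_of_nonneg_left (by linarith) hB
  · rw [Counted.ops_pure, Nat.cast_zero]
    exact mul_nonneg hB (by linarith)
termination_by N - j
decreasing_by omega

end Cost

/-! ## Costs of straight-line programs -/

section Programs

variable {k α : Type u} {σ : Type} {R : Arith k α} {c : ℝ}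

/-- Each operation of `R` costs at most `c` operations of the base field. -/
structure Arith.BoundedBy (R : Arith k α) (c : ℝ) : Prop where
  add : ∀ a b, ((R.add a b).ops : ℝ) ≤ c
  sub : ∀ a b, ((R.sub a b).ops : ℝ) ≤ c
  mul : ∀ a b, ((R.mul a b).ops : ℝ) ≤ c

theorem RingOp.exec_ops_le (hR : R.BoundedBy c) (op : RingOp) (a b : α) :
    ((op.exec R a b).ops : ℝ) ≤ c := by
  cases op
  · exact hR.add a b
  · exact hR.sub a b
  · exact hR.mul a b

theorem SLP.run_ops_le (hR : R.BoundedBy c) (x : σ → α) {L : ℕ} (p : SLP k σ L) :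
    ((p.run R x).ops : ℝ) ≤ L * c := by
  induction p with
  | nil => simp [SLP.run]
  | snoc p op a b ih =>
    refine le_trans (Counted.ops_bind_le ih (Counted.ops_bind_le (op.exec_ops_le hR _ _)
      (Counted.ops_pure_le _))) ?_
    push_cast
    linarith

variable [DecidableEq σ]

theorem Operand.accumulate_ops_le {f : α → α → Counted α} (hc : 0 ≤ c)
    (hf : ∀ a b, ((f a b).ops : ℝ) ≤ c) {L : ℕ} (o : Operand k σ L) (d : α)
    (g : Adjoints σ L α) : ((o.accumulate f d g).ops : ℝ) ≤ c := by
  cases o with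
  | var s => simpa [Operand.accumulate] using hf _ _
  | const _ => simpa [Operand.accumulate] using hc
  | reg i => simpa [Operand.accumulate] using hf _ _

theorem SLP.backward_ops_le (hc : 0 ≤ c) (hR : R.BoundedBy c) (x : σ → α) {L : ℕ}
    (p : SLP k σ L) (val : Fin L → α) (g : Adjoints σ L α) :
    ((p.backward R x val g).ops : ℝ) ≤ L * (4 * c) := by
  induction p with
  | nil => simp [SLP.backward]
  | snoc p op a b ih =>
    cases op
    · refine le_trans (Counted.ops_bind_le (a.accumulate_ops_le hc hR.add _ _)
        (Counted.ops_bind_le (b.accumulate_ops_le hc hR.add _ _) (ih _ _))) ?_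
      push_cast
      linarith
    · refine le_trans (Counted.ops_bind_le (a.accumulate_ops_le hc hR.add _ _)
        (Counted.ops_bind_le (b.accumulate_ops_le hc hR.sub _ _) (ih _ _))) ?_
      push_cast
      linarith
    · refine le_trans (Counted.ops_bind_le (hR.mul _ _) (Counted.ops_bind_le (hR.mul _ _)
        (Counted.ops_bind_le (a.accumulate_ops_le hc hR.add _ _)
        (Counted.ops_bind_le (b.accumulate_ops_le hc hR.add _ _) (ih _ _))))) ?_
      push_cast
      linarith

/-- Two operations seed the adjoints and a product instruction, the worst case, takes four. The
number of variables does not enter, which keeps the factor `n + l` away from `L`. -/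
theorem SLP.gradient_ops_le [Field k] (hc : 0 ≤ c) (hR : R.BoundedBy c) (x : σ → α) {L : ℕ}
    (p : SLP k σ L) (val : Fin L → α) (o₁ : Operand k σ L) (c₁ : α) (o₂ : Operand k σ L)
    (c₂ : α) : ((p.gradient R x val o₁ c₁ o₂ c₂).ops : ℝ) ≤ (2 + 4 * L) * c := by
  refine le_trans (Counted.ops_bind_le (o₁.accumulate_ops_le hc hR.add _ _)
    (Counted.ops_bind_le (o₂.accumulate_ops_le hc hR.add _ _)
      (p.backward_ops_le hc hR _ _ _))) ?_
  linarith

end Programs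

/-! ## Lower bounds for multiplication algorithms -/

section LowerBounds

variable {k : Type u} [Field k]

/-- A straight-line program needs one instruction for each of its quadratic outputs, if these are
separated by points. -/
theorem SLP.card_le_length {σ ι : Type} [Fintype ι] [DecidableEq ι] {L : ℕ} (p : SLP k σ L)
    (out : ι → Operand k σ L) (x : ι → σ → k)
    (hhom : ∀ i, (p.poly (out i)).IsHomogeneous 2)
    (hx : ∀ i j, MvPolynomial.eval (x i) (p.poly (out j)) = if i = j then 1 else 0) :
    Fintype.card ι ≤ L := by
  have hne : ∀ i, p.poly (out i) ≠ 0 := fun i h => by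
    have := hx i i
    simp [h] at this
  -- A nonzero form of degree 2 is neither a variable (degree 1) nor a constant (degree 0).
  have hreg : ∀ i, ∃ a, out i = .reg a := fun i => by
    have hh := hhom i
    have h0 := hne i
    cases ho : out i with
    | var s =>
      rw [ho] at hh h0
      exact absurd ((MvPolynomial.isHomogeneous_X k s).inj_right hh h0) (by norm_num)
    | const c =>
      rw [ho] at hh h0
      exact absurd ((MvPolynomial.isHomogeneous_C σ c).inj_right hh h0) (by norm_num)
    | reg a => exact ⟨a, rfl⟩
  choose f hf using hreg
  -- Two outputs in one register would be the same polynomial, but the point `x i` gives them the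
  -- values 1 and 0.
  have hinj : Function.Injective f := fun i j hij => by
    by_contra hne'
    have h₁ := hx i i
    have h₂ := hx i j
    rw [hf j, ← hij, ← hf i, h₁] at h₂
    simp [hne'] at h₂
  simpa using Fintype.card_le_of_injective f hinj

theorem SeriesMultiplication.succ_le_M (S : SeriesMultiplication k) (j : ℕ) : j + 1 ≤ S.M j := by
  have h := (S.prog j).card_le_length (S.out j)
    -- The separating points are the products `t ^ i * 1`.
    (fun i => Sum.elim (fun a => if a = i then 1 else 0) (fun b => if b = 0 then 1 else 0))
    (fun i => by
      rw [S.correct]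
      refine MvPolynomial.IsHomogeneous.sum _ _ _ fun a _ =>
        MvPolynomial.IsHomogeneous.sum _ _ _ fun b _ => ?_
      split_ifs
      · exact (MvPolynomial.isHomogeneous_X k _).mul (MvPolynomial.isHomogeneous_X k _)
      · exact MvPolynomial.isHomogeneous_zero _ _ _)
    (fun i l => by
      rw [S.correct]
      simp only [map_sum, apply_ite (MvPolynomial.eval _), map_mul, MvPolynomial.eval_X,
        map_zero, Sum.elim_inl, Sum.elim_inr]
      rw [Finset.sum_eq_single i (fun a _ ha => by simp [ha]) (by simp),
        Finset.sum_eq_single 0 (fun b _ hb => by simp [hb]) (by simp)]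
      simp [Fin.ext_iff])
  simpa using h

theorem MatrixMultiplication.sq_le_Mat (T : MatrixMultiplication k) (N : ℕ) :
    N * N ≤ T.Mat N := by
  have h := (T.prog N).card_le_length (ι := Fin N × Fin N) (fun p => T.out N p.1 p.2)
    -- Row `p.1` filled with ones, times the elementary matrix at `p`, is again the elementary
    -- matrix at `p`.
    (fun p => Sum.elim (fun a => if a.1 = p.1 then 1 else 0)
      (fun b => if b.1 = p.1 ∧ b.2 = p.2 then 1 else 0))
    (fun p => by
      rw [T.correct]
      exact MvPolynomial.IsHomogeneous.sum _ _ _ fun l _ =>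
        (MvPolynomial.isHomogeneous_X k _).mul (MvPolynomial.isHomogeneous_X k _))
    (fun p q => by
      rw [T.correct]
      simp only [map_sum, map_mul, MvPolynomial.eval_X, Sum.elim_inl, Sum.elim_inr]
      rw [Finset.sum_eq_single p.1 (fun a _ ha => by simp [ha]) (by simp)]
      by_cases h₁ : q.1 = p.1 <;> by_cases h₂ : q.2 = p.2 <;>
        simp [h₁, h₂, Prod.ext_iff, eq_comm (a := p.1), eq_comm (a := p.2)])
  simpa using h

/-- Comparing an order with itself forces this because `M 0` is positive. It allows lower powers of
`κ` to be absorbed into higher ones. -/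
theorem SeriesMultiplication.Regular.one_le {S : SeriesMultiplication k} {κ : ℝ}
    (hS : S.Regular κ) : 1 ≤ κ := by
  have h := hS 0 0 le_rfl
  have h₁ : (1 : ℝ) ≤ S.M 0 := by exact_mod_cast S.succ_le_M 0
  simp only [Nat.cast_zero, zero_add, div_one] at h
  nlinarith

end LowerBounds

/-! ## Costs of the operations on series and on matrices -/

section Series

variable {k : Type u} [Field k] (S : SeriesMultiplication k) (T : MatrixMultiplication k)

theorem SeriesMultiplication.cast_succ_le_M (j : ℕ) : (j : ℝ) + 1 ≤ S.M j := by
  exact_mod_cast S.succ_le_M j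

theorem SeriesMultiplication.one_le_cast_M (j : ℕ) : (1 : ℝ) ≤ S.M j := by
  have := S.cast_succ_le_M j
  have : (0 : ℝ) ≤ j := j.cast_nonneg
  linarith

theorem MatrixMultiplication.cast_sq_le_Mat (N : ℕ) : (N : ℝ) * N ≤ T.Mat N := by
  exact_mod_cast T.sq_le_Mat N

theorem regArith_boundedBy : (regArith (k := k)).BoundedBy 1 :=
  ⟨fun _ _ => by simp [regArith, Reg.add], fun _ _ => by simp [regArith, Reg.sub],
    fun _ _ => by simp [regArith, Reg.mul]⟩

theorem coefficientwise_ops_le (j : ℕ) {f : ℕ → Counted (Reg k)} (h : ∀ i, (f i).ops ≤ 1) :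
    ((forNat ⟨0⟩ (j + 1) f).ops : ℝ) ≤ S.M j := by
  refine le_trans (forNat_ops_le (c := 1) fun i => by exact_mod_cast h i) ?_
  simpa using S.cast_succ_le_M j

theorem Ser.add_ops_le (j : ℕ) (a b : Ser k) : ((Ser.add j a b).ops : ℝ) ≤ S.M j :=
  coefficientwise_ops_le S j fun _ => le_rfl

theorem Ser.sub_ops_le (j : ℕ) (a b : Ser k) : ((Ser.sub j a b).ops : ℝ) ≤ S.M j :=
  coefficientwise_ops_le S j fun _ => le_rfl

theorem Ser.deriv_ops_le (j : ℕ) (a : Ser k) : ((Ser.deriv j a).ops : ℝ) ≤ S.M j :=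
  coefficientwise_ops_le S j fun _ => le_rfl

theorem Ser.integral_ops_le (j : ℕ) (a : Ser k) : ((Ser.integral j a).ops : ℝ) ≤ S.M j :=
  coefficientwise_ops_le S j fun i => by
    split_ifs
    · exact Nat.zero_le _
    · exact le_rfl

theorem Ser.mul_ops_le (j : ℕ) (a b : Ser k) : ((Ser.mul S j a b).ops : ℝ) ≤ S.M j := by
  refine le_trans (Counted.ops_bind_le ((S.prog j).run_ops_le regArith_boundedBy _)
    (Counted.ops_pure_le _)) ?_
  simp

theorem serArith_boundedBy (j : ℕ) : (serArith S j).BoundedBy (S.M j) :=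
  ⟨Ser.add_ops_le S j, Ser.sub_ops_le S j, Ser.mul_ops_le S j⟩

theorem Table.mul_ops_le {α : Type u} {R : Arith k α} {c : ℝ} (hR : R.BoundedBy c) (N : ℕ)
    (A B : Table α) : ((Table.mul R T N A B).ops : ℝ) ≤ T.Mat N * c := by
  refine le_trans (Counted.ops_bind_le ((T.prog N).run_ops_le hR _) (Counted.ops_pure_le _)) ?_
  simp

theorem matMul_ops_le (N j : ℕ) {a b c : ℕ} (A : Fin a → Fin b → Ser k)
    (B : Fin b → Fin c → Ser k) : ((matMul S T N j A B).ops : ℝ) ≤ T.Mat N * S.M j := by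
  refine le_trans (Counted.ops_bind_le (Table.mul_ops_le T (serArith_boundedBy S j) N _ _)
    (Counted.ops_pure_le _)) ?_
  simp

variable {S}

/-- Quadratic iteration costs at most `3 κ` times as much as its last step. -/
theorem newtonLoop_ops_le {κ : ℝ} (hS : S.Regular κ) {α : Type u} (step : ℕ → α → Counted α)
    (N : ℕ) {c : ℝ} (hc : 0 ≤ c) (h : ∀ q s, ((step q s).ops : ℝ) ≤ c * S.M q) (s : α) :
    ((newtonLoop step N 0 s).ops : ℝ) ≤ 3 * κ * (c * S.M N) := by
  have hκ := hS.one_le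
  have hN : (0 : ℝ) < N + 1 := by positivity
  -- By regularity this is a uniform price per coefficient for every order up to `N`.
  have hB : 0 ≤ c * (κ * (S.M N / (N + 1))) := by positivity
  refine le_trans (newtonLoop_ops_le_of_le step N hB (fun q hq s => ?_) 0 (Nat.zero_le _) s) ?_
  · refine (h q s).trans ?_
    rw [mul_assoc]
    refine mul_le_mul_of_nonneg_left ?_ hc
    have := hS q N hq
    rwa [div_le_iff₀ (by positivity)] at this
  · calc c * (κ * (S.M N / (N + 1))) * (3 * (N + 1) - 2 * ((0 : ℕ) + 1))
        ≤ c * (κ * (S.M N / (N + 1))) * (3 * (N + 1)) := by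
          refine mul_le_mul_of_nonneg_left ?_ hB
          norm_num
      _ = 3 * κ * (c * S.M N) := by field_simp

theorem Ser.inv_ops_le {κ : ℝ} (hS : S.Regular κ) (N : ℕ) (a : Ser k) :
    ((Ser.inv S N a).ops : ℝ) ≤ 13 * κ * S.M N := by
  have hκ := hS.one_le
  have h₁ := S.one_le_cast_M N
  refine le_trans (Counted.ops_bind_le (p := 1) Nat.cast_one.le (newtonLoop_ops_le hS _ N
    (c := 4) (by norm_num) (fun q b => ?_) _)) ?_
  · refine le_trans (Counted.ops_bind_le (Ser.mul_ops_le S q _ _) (Counted.ops_bind_le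
      (Ser.mul_ops_le S q _ _) (Counted.ops_bind_le (Ser.add_ops_le S q _ _)
      (Ser.sub_ops_le S q _ _)))) ?_
    linarith
  · nlinarith

end Series

/-! ## Cost of the main loop and of the evaluation of the outputs -/

section Newton

variable {k : Type u} [Field k] {S : SeriesMultiplication k} (T : MatrixMultiplication k)

theorem MatrixMultiplication.cast_mul_le_Mat {N a b : ℕ} (ha : a ≤ N) (hb : b ≤ N) :
    (a : ℝ) * b ≤ T.Mat N := by
  exact_mod_cast (Nat.mul_le_mul ha hb).trans (T.sq_le_Mat N)

theorem MatrixMultiplication.cast_le_Mat {N a : ℕ} (ha : a ≤ N) : (a : ℝ) ≤ T.Mat N := by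
  rcases Nat.eq_zero_or_pos a with rfl | h
  · simp
  · simpa using T.cast_mul_le_Mat (b := 1) ha (h.trans_le ha)

/-- The vectors contribute at most 5 `Mat`, the two products 2, and the entrywise work on the
matrices `3 + 4`. The forward run and the `n` gradients add `(1 + 4 n) L`, where `1 ≤ n` absorbs the
single run. -/
theorem evalVariational_ops_le {n l r m L : ℕ} (hn : 1 ≤ n)
    (sys : StateSpaceSystem k n l r m L) (z : Specialization k n l r) (j : ℕ)
    (s : Approx k n l) : ((evalVariational S T sys z j s).ops : ℝ) ≤
      14 * ((T.Mat (n + l) + n * L) * S.M j) := by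
  have hμ : (0 : ℝ) ≤ S.M j := Nat.cast_nonneg _
  have h₁ := mul_le_mul_of_nonneg_right (T.cast_le_Mat (Nat.le_add_right n l)) hμ
  have h₂ := mul_le_mul_of_nonneg_right
    (T.cast_mul_le_Mat (Nat.le_add_right n l) (Nat.le_add_right n l)) hμ
  have h₃ := mul_le_mul_of_nonneg_right
    (T.cast_mul_le_Mat (Nat.le_add_right n l) (Nat.le_add_left l n)) hμ
  have h₄ : (1 : ℝ) * (L * S.M j) ≤ n * (L * S.M j) :=
    mul_le_mul_of_nonneg_right (by exact_mod_cast hn) (by positivity)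
  have h₅ : (0 : ℝ) ≤ n * (L * S.M j) := by positivity
  refine le_trans (Counted.ops_bind_le (SLP.run_ops_le (serArith_boundedBy S j) _ _)
    (Counted.ops_bind_le (forFin_ops_le fun i => Ser.deriv_ops_le S j _)
    (Counted.ops_bind_le (forFin_ops_le fun i =>
      Counted.ops_bind_le (Ser.mul_ops_le S j _ _) (Ser.sub_ops_le S j _ _))
    (Counted.ops_bind_le (forFin_ops_le fun i =>
      SLP.gradient_ops_le hμ (serArith_boundedBy S j) _ _ _ _ _ _ _)
    (Counted.ops_bind_le (matMul_ops_le S T _ j _ _)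
    (Counted.ops_bind_le (forFin₂_ops_le fun i a =>
      Counted.ops_bind_le (Ser.deriv_ops_le S j _)
      (Counted.ops_bind_le (Ser.mul_ops_le S j _ _) (Ser.add_ops_le S j _ _)))
    (Counted.ops_bind_le (matMul_ops_le S T _ j _ _)
    (Counted.ops_bind_le (forFin₂_ops_le fun i a =>
      Counted.ops_bind_le (Ser.deriv_ops_le S j _)
      (Counted.ops_bind_le (Ser.mul_ops_le S j _ _)
      (Counted.ops_bind_le (Ser.add_ops_le S j _ _) (Ser.add_ops_le S j _ _))))
    (Counted.ops_pure_le _))))))))) ?_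
  linarith

/-- One step has five matrix products and six series operations per entry, hence 11; the iteration
multiplies this by `3 κ`. -/
theorem homogeneousResolution_ops_le {κ : ℝ} (hS : S.Regular κ) {size n : ℕ} (hn : n ≤ size)
    (N : ℕ) (H : Fin n → Fin n → Ser k) :
    ((homogeneousResolution S T size N H).ops : ℝ) ≤ 33 * κ * (T.Mat size * S.M N) := by
  rw [homogeneousResolution]
  refine le_trans (newtonLoop_ops_le hS _ N (c := 11 * T.Mat size) (by positivity)
    (fun q s => ?_) _) (le_of_eq (by ring))
  have h₂ := mul_le_mul_of_nonneg_right (T.cast_mul_le_Mat hn hn) (S.M q).cast_nonneg (α := ℝ)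
  refine le_trans (Counted.ops_bind_le (matMul_ops_le S T _ q _ _)
    (Counted.ops_bind_le (forFin₂_ops_le fun i a =>
      Counted.ops_bind_le (Ser.deriv_ops_le S q _) (Ser.add_ops_le S q _ _))
    (Counted.ops_bind_le (matMul_ops_le S T _ q _ _)
    (Counted.ops_bind_le (forFin₂_ops_le fun i a => Ser.integral_ops_le S q _)
    (Counted.ops_bind_le (matMul_ops_le S T _ q _ _)
    (Counted.ops_bind_le (forFin₂_ops_le fun i a => Ser.sub_ops_le S q _ _)
    (Counted.ops_bind_le (matMul_ops_le S T _ q _ _)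
    (Counted.ops_bind_le (matMul_ops_le S T _ q _ _)
    (Counted.ops_bind_le (forFin₂_ops_le fun i a =>
      Counted.ops_bind_le (Ser.add_ops_le S q _ _) (Ser.sub_ops_le S q _ _))
    (Counted.ops_pure_le _)))))))))) ?_
  linarith

theorem constantsVariation_ops_le {size n c : ℕ} (hn : n ≤ size) (hc : c ≤ size) (j : ℕ)
    (Ainv : Fin n → Ser k) (F : Fundamental k n) (Q : Fin n → Fin c → Ser k) :
    ((constantsVariation S T size j Ainv F Q).ops : ℝ) ≤ 4 * (T.Mat size * S.M j) := by
  have h₂ := mul_le_mul_of_nonneg_right (T.cast_mul_le_Mat hn hc) (S.M j).cast_nonneg (α := ℝ)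
  refine le_trans (Counted.ops_bind_le (forFin₂_ops_le fun i a => Ser.mul_ops_le S j _ _)
    (Counted.ops_bind_le (matMul_ops_le S T _ j _ _)
    (Counted.ops_bind_le (forFin₂_ops_le fun i a => Ser.integral_ops_le S j _)
    (matMul_ops_le S T _ j _ _)))) ?_
  linarith

/-- The total is `30 + 46 κ`: the part with `κ` comes from inverting the diagonal (13) and from the
fundamental matrix (33). -/
theorem newtonStep_ops_le {κ : ℝ} (hS : S.Regular κ) {n l r m L : ℕ} (hn : 1 ≤ n)
    (sys : StateSpaceSystem k n l r m L) (z : Specialization k n l r) (j : ℕ)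
    (s : Approx k n l) : ((newtonStep S T sys z j s).ops : ℝ) ≤
      76 * κ * (T.Mat (n + l) + n * L) * S.M j := by
  have hκ := hS.one_le
  have hμ : (0 : ℝ) ≤ S.M j := Nat.cast_nonneg _
  have hnN : n ≤ n + l := Nat.le_add_right n l
  have hlN : l ≤ n + l := Nat.le_add_left l n
  have h₁ := mul_le_mul_of_nonneg_right (T.cast_le_Mat hnN) hμ
  have h₁' := mul_le_mul_of_nonneg_left h₁ (zero_le_one.trans hκ)
  have h₂ := mul_le_mul_of_nonneg_right (T.cast_mul_le_Mat hnN hnN) hμ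
  have h₃ := mul_le_mul_of_nonneg_right (T.cast_mul_le_Mat hnN hlN) hμ
  have h₄ : 1 * ((T.Mat (n + l) + n * L : ℝ) * S.M j) ≤ κ * ((T.Mat (n + l) + n * L) * S.M j) :=
    mul_le_mul_of_nonneg_right hκ (by positivity)
  have h₅ : (0 : ℝ) ≤ n * L * S.M j := by positivity
  have h₆ : 0 ≤ κ * (n * L * S.M j) := by positivity
  refine le_trans (Counted.ops_bind_le (evalVariational_ops_le T hn sys z j s)
    (Counted.ops_bind_le (forFin_ops_le fun i => Ser.inv_ops_le hS j _)
    (Counted.ops_bind_le (forFin₂_ops_le fun i a => Ser.mul_ops_le S j _ _)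
    (Counted.ops_bind_le (homogeneousResolution_ops_le T hS hnN j _)
    (Counted.ops_bind_le (constantsVariation_ops_le T hnN (hn.trans hnN) j _ _ _)
    (Counted.ops_bind_le (constantsVariation_ops_le T hnN hnN j _ _ _)
    (Counted.ops_bind_le (constantsVariation_ops_le T hnN hlN j _ _ _)
    (Counted.ops_bind_le (forFin_ops_le fun i => Ser.sub_ops_le S j _ _)
    (Counted.ops_bind_le (forFin₂_ops_le fun i a => Ser.sub_ops_le S j _ _)
    (Counted.ops_bind_le (forFin₂_ops_le fun i a => Ser.sub_ops_le S j _ _)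
    (Counted.ops_pure_le _))))))))))) ?_
  linarith

/-- The loop costs `3 κ` steps of the final order and the repetition one more; the steps carry their
own factor `κ`, hence `κ ^ 2`. -/
theorem solveVariational_ops_le {κ : ℝ} (hS : S.Regular κ) {n l r m L : ℕ} (hn : 1 ≤ n)
    (sys : StateSpaceSystem k n l r m L) (z : Specialization k n l r) (ν : ℕ) :
    ((solveVariational S T sys z ν).ops : ℝ) ≤
      304 * κ ^ 2 * (S.M ν * (T.Mat (n + l) + n * L)) := by
  have hκ := hS.one_le
  refine le_trans (Counted.ops_bind_le (newtonLoop_ops_le hS _ ν (by positivity)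
    (newtonStep_ops_le T hS hn sys z) _) (newtonStep_ops_le T hS hn sys z ν _)) ?_
  have : κ * (76 * ((T.Mat (n + l) + n * L) * S.M ν)) ≤
      κ ^ 2 * (76 * ((T.Mat (n + l) + n * L) * S.M ν)) :=
    mul_le_mul_of_nonneg_right (by nlinarith) (by positivity)
  linarith

theorem evalOutput_ops_le {κ : ℝ} (hS : S.Regular κ) {n l r m L : ℕ} (hn : 1 ≤ n) (hm : m ≤ n)
    (sys : StateSpaceSystem k n l r m L) (z : Specialization k n l r) (j : ℕ)
    (s : Approx k n l) : ((evalOutput S T sys z j s).ops : ℝ) ≤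
      21 * κ * (S.M j * (T.Mat (n + l) + (n + m) * L)) := by
  have hκ := hS.one_le
  have hμ : (0 : ℝ) ≤ S.M j := Nat.cast_nonneg _
  have hmN : m ≤ n + l := hm.trans (Nat.le_add_right n l)
  have h₁ := mul_le_mul_of_nonneg_right (T.cast_le_Mat hmN) hμ
  have h₁' := mul_le_mul_of_nonneg_left h₁ (zero_le_one.trans hκ)
  have h₃ := mul_le_mul_of_nonneg_right (T.cast_mul_le_Mat hmN (Nat.le_add_left l n)) hμ
  have h₄ : (1 : ℝ) * (L * S.M j) ≤ n * (L * S.M j) :=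
    mul_le_mul_of_nonneg_right (by exact_mod_cast hn) (by positivity)
  have h₅ : 1 * (S.M j * (T.Mat (n + l) + (n + m) * L : ℝ)) ≤
      κ * (S.M j * (T.Mat (n + l) + (n + m) * L)) :=
    mul_le_mul_of_nonneg_right hκ (by positivity)
  have h₆ : 0 ≤ κ * (S.M j * ((n + m) * L)) := by positivity
  have h₇ : (0 : ℝ) ≤ n * L * S.M j := by positivity
  have h₈ : (0 : ℝ) ≤ m * L * S.M j := by positivity
  refine le_trans (Counted.ops_bind_le (SLP.run_ops_le (serArith_boundedBy S j) _ _)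
    (Counted.ops_bind_le (forFin_ops_le fun i =>
      Counted.ops_bind_le (Ser.inv_ops_le hS j _)
      (Counted.ops_bind_le (Ser.mul_ops_le S j _ _)
      (Counted.ops_bind_le (Ser.mul_ops_le S j _ _)
      (Counted.ops_bind_le (Ser.sub_ops_le S j _ _)
      (SLP.gradient_ops_le hμ (serArith_boundedBy S j) _ _ _ _ _ _ _)))))
    (Counted.ops_bind_le (matMul_ops_le S T _ j _ _)
    (Counted.ops_bind_le (matMul_ops_le S T _ j _ _)
    (Counted.ops_bind_le (forFin₂_ops_le fun i a => Ser.add_ops_le S j _ _)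
    (Counted.ops_pure_le _)))))) ?_
  linarith

end Newton

/-! ## Cost of the rank computation -/

section Rank

variable {k : Type u} [Field k] (T : MatrixMultiplication k)

theorem MatrixMultiplication.Regular.one_le {T : MatrixMultiplication k} {ε κ : ℝ}
    (hT : T.Regular ε κ) : 1 ≤ κ := by
  have h := hT 1 1 le_rfl le_rfl
  have h₁ : (1 : ℝ) ≤ T.Mat 1 := by exact_mod_cast T.sq_le_Mat 1
  simp only [Nat.cast_one, Real.one_rpow, div_one] at h
  nlinarith

theorem Table.mulWide_ops_le {N b : ℕ} (hN : 1 ≤ N) (hb : N ≤ b) (A B : Table (Reg k)) :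
    ((Table.mulWide T N b A B).ops : ℝ) ≤ 2 * (T.Mat N * b / N) := by
  have hN' : (0 : ℝ) < N := by exact_mod_cast hN
  -- Rounding up the number of slices costs at most a factor 2 because `N ≤ b`.
  have hs : (((b + N - 1) / N : ℕ) : ℝ) ≤ 2 * (b / N) := by
    refine Nat.cast_div_le.trans ?_
    rw [← mul_div_assoc]
    refine div_le_div_of_nonneg_right ?_ hN'.le
    exact_mod_cast (by omega : b + N - 1 ≤ 2 * b)
  refine le_trans (Counted.ops_bind_le (forNat_ops_le fun e =>
    Table.mul_ops_le T regArith_boundedBy N _ _) (Counted.ops_pure_le _)) ?_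
  rw [add_zero, mul_one]
  calc _ ≤ 2 * (b / N) * (T.Mat N : ℝ) := mul_le_mul_of_nonneg_right hs (Nat.cast_nonneg _)
    _ = _ := by ring

variable [DecidableEq k]

theorem firstPivot_rank_le (x : ℕ → Reg k) (t c : ℕ) : (firstPivot x t c).result.rank ≤ 1 := by
  induction t generalizing c with
  | zero => simp [firstPivot, Pivots.rank]
  | succ t ih =>
    rw [firstPivot, Reg.ifZero]
    split_ifs
    · exact ih _
    · simp [Pivots.rank]

theorem firstPivot_ops_le (x : ℕ → Reg k) (t c : ℕ) : (firstPivot x t c).ops ≤ t + 1 := by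
  induction t generalizing c with
  | zero => simp [firstPivot]
  | succ t ih =>
    rw [firstPivot, Reg.ifZero]
    split_ifs
    · exact Nat.succ_le_succ (ih _)
    · simp [Reg.div]

/-- The loops of the block inversion have lengths equal to computed ranks, so their cost needs this
bound, which does not depend on the data. -/
theorem pivots_rank_le (b a : ℕ) (A : Table (Reg k)) : (pivots T b a A).result.rank ≤ a := by
  induction a using Nat.strong_induction_on generalizing A with
  | _ a ih =>
    match a with
    | 0 => simp [pivots, Pivots.rank]
    | 1 =>
      rw [pivots]
      exact firstPivot_rank_le _ _ _
    | a + 2 =>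
      rw [pivots]
      simp only [Counted.result_bind, Counted.result_pure, Pivots.rank, List.length_append]
      exact (Nat.add_le_add (ih ((a + 2) / 2) (by omega) _)
        (ih ((a + 2) - (a + 2) / 2) (by omega) _)).trans_eq (by omega)

/-- The cost of one level of the recursive elimination. -/
theorem pivots_ops_add_two_le {a b : ℕ} (hab : a + 2 ≤ b) (A : Table (Reg k)) {c₁ c₂ : ℝ}
    (h₁ : ∀ A, ((pivots T b ((a + 2) / 2) A).ops : ℝ) ≤ c₁)
    (h₂ : ∀ A, ((pivots T b ((a + 2) - (a + 2) / 2) A).ops : ℝ) ≤ c₂) :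
    ((pivots T b (a + 2) A).ops : ℝ) ≤ c₁ + c₂ +
      11 * (T.Mat ((a + 2) - (a + 2) / 2) * b / ((a + 2 - (a + 2) / 2 : ℕ) : ℝ)) := by
  have hrank₁ := fun A => (pivots_rank_le T b ((a + 2) / 2) A).trans
    (by omega : (a + 2) / 2 ≤ (a + 2) - (a + 2) / 2)
  have hrank₂ := fun A => pivots_rank_le T b ((a + 2) - (a + 2) / 2) A
  have hN : 1 ≤ (a + 2) - (a + 2) / 2 := by omega
  have hNb : (a + 2) - (a + 2) / 2 ≤ b := by omega
  have hw := fun A B => Table.mulWide_ops_le (k := k) T hN hNb A B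
  rw [pivots]
  generalize (a + 2) - (a + 2) / 2 = N at *
  have hN' : (0 : ℝ) < N := by exact_mod_cast hN
  have hone : ∀ x y : Reg k, ((x.sub y).ops : ℝ) ≤ 1 := fun _ _ => Nat.cast_one.le
  have hone' : ∀ x y : Reg k, ((x.add y).ops : ℝ) ≤ 1 := fun _ _ => Nat.cast_one.le
  have hmul := fun A B => Table.mul_ops_le T (regArith_boundedBy (k := k)) N A B
  -- The constant 11 collects five square products, 2 for the wide product, 1 for the subtraction in
  -- the second half and 3 for the blocks of the inverse.
  refine le_trans (Counted.ops_bind_le (h₁ _) (Counted.ops_bind_le (hmul _ _)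
    (Counted.ops_bind_le (hw _ _)
    (Counted.ops_bind_le (forNat₂_ops_le fun i j => hone _ _)
    (Counted.ops_bind_le (h₂ _)
    (Counted.ops_bind_le (hmul _ _) (Counted.ops_bind_le (hmul _ _)
    (Counted.ops_bind_le (hmul _ _) (Counted.ops_bind_le (hmul _ _)
    (Counted.ops_bind_le (p := T.Mat N)
      (le_trans (forNat₂_ops_le fun i j => hone' _ _) ?_)
    (Counted.ops_bind_le (p := T.Mat N)
      (le_trans (forNat₂_ops_le fun i j => hone _ _) ?_)
    (Counted.ops_bind_le (p := T.Mat N)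
      (le_trans (forNat₂_ops_le fun i j => hone _ _) ?_)
    (Counted.ops_pure_le _))))))))))))) ?_
  · rw [mul_one]
    exact T.cast_mul_le_Mat (hrank₁ _) (hrank₁ _)
  · rw [mul_one]
    exact T.cast_mul_le_Mat (hrank₁ _) (hrank₂ _)
  · rw [mul_one]
    exact T.cast_mul_le_Mat (hrank₂ _) (hrank₁ _)
  · have hbN : (1 : ℝ) ≤ b / N := by
      rw [one_le_div hN']
      exact_mod_cast hNb
    have h₃ : (T.Mat N : ℝ) * 1 ≤ T.Mat N * (b / N) :=
      mul_le_mul_of_nonneg_left hbN (Nat.cast_nonneg _)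
    have h₄ : (N : ℝ) * b ≤ T.Mat N * (b / N) := by
      calc (N : ℝ) * b = N * N * (b / N) := by field_simp
        _ ≤ _ := mul_le_mul_of_nonneg_right (T.cast_sq_le_Mat N) (by positivity)
    rw [mul_div_assoc]
    linarith

/-- The power `1 + ε` of a number exceeds the sum of those of its two halves by a constant
factor. -/
theorem rpow_half_add_rpow_half_le {ε : ℝ} (hε : 0 < ε) (a : ℕ) (ha : 2 ≤ a) :
    ((a / 2 : ℕ) : ℝ) ^ (1 + ε) + ((a - a / 2 : ℕ) : ℝ) ^ (1 + ε) ≤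
      (2 / 3 : ℝ) ^ ε * (a : ℝ) ^ (1 + ε) := by
  -- Even the larger half is at most `2 a / 3` once `a ≥ 2`, with equality at `a = 3`; this is the
  -- source of the ratio `2/3`.
  have hsplit : ∀ h : ℕ, 3 * h ≤ 2 * a →
      (h : ℝ) ^ (1 + ε) ≤ h * ((2 / 3 : ℝ) ^ ε * (a : ℝ) ^ ε) := fun h hh => by
    rw [Real.rpow_add_of_nonneg h.cast_nonneg zero_le_one hε.le, Real.rpow_one,
      ← Real.mul_rpow (by norm_num) a.cast_nonneg]
    refine mul_le_mul_of_nonneg_left (Real.rpow_le_rpow h.cast_nonneg ?_ hε.le) h.cast_nonneg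
    have : (3 : ℝ) * h ≤ 2 * a := by exact_mod_cast hh
    linarith
  refine (add_le_add (hsplit _ (by omega)) (hsplit _ (by omega))).trans_eq ?_
  rw [← add_mul, ← Nat.cast_add, Nat.add_sub_of_le (Nat.div_le_self a 2),
    Real.rpow_add_of_nonneg a.cast_nonneg zero_le_one hε.le, Real.rpow_one]
  ring

/-- The constant of the rank computation. -/
noncomputable def rankConstant (ε : ℝ) : ℝ := 11 / (1 - (2 / 3 : ℝ) ^ ε)

theorem rpow_lt_one_of_two_thirds {ε : ℝ} (hε : 0 < ε) : (2 / 3 : ℝ) ^ ε < 1 :=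
  Real.rpow_lt_one (by norm_num) (by norm_num) hε

theorem le_rankConstant {ε : ℝ} (hε : 0 < ε) : 11 ≤ rankConstant ε := by
  have h₁ := rpow_lt_one_of_two_thirds hε
  have h₀ : (0 : ℝ) ≤ (2 / 3 : ℝ) ^ ε := by positivity
  rw [rankConstant, le_div_iff₀ (by linarith)]
  linarith

/-- Induction on the rows closes because `D = rankConstant ε` solves `D = (2/3) ^ ε * D + 11`. The
assumption `1 ≤ K` serves the single row, where there is at most one test per column and one
division. -/
theorem pivots_ops_le {ε K : ℝ} (hε : 0 < ε) (hK : 1 ≤ K) (b a : ℕ) (hab : a ≤ b)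
    (hT : ∀ i, 1 ≤ i → i ≤ a → (T.Mat i : ℝ) ≤ K * (i : ℝ) ^ (2 + ε)) (A : Table (Reg k)) :
    ((pivots T b a A).ops : ℝ) ≤ rankConstant ε * K * b * (a : ℝ) ^ (1 + ε) := by
  have hD := le_rankConstant hε
  induction a using Nat.strong_induction_on generalizing A with
  | _ a ih =>
    match a with
    | 0 =>
      simp only [pivots, Counted.ops_pure, Nat.cast_zero]
      positivity
    | 1 =>
      rw [pivots, Nat.cast_one, Real.one_rpow, mul_one]
      have hb : (1 : ℝ) ≤ b := by exact_mod_cast hab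
      have h : ((firstPivot (A 0) b 0).ops : ℝ) ≤ b + 1 := by
        exact_mod_cast firstPivot_ops_le (A 0) b 0
      refine h.trans ?_
      have : 11 * 1 ≤ rankConstant ε * K := mul_le_mul hD hK zero_le_one (by linarith)
      nlinarith
    | a + 2 =>
      have hh : (a + 2) / 2 < a + 2 := by omega
      have hN : (a + 2) - (a + 2) / 2 < a + 2 := by omega
      have hN₁ : 1 ≤ (a + 2) - (a + 2) / 2 := by omega
      refine (pivots_ops_add_two_le T hab A
        (fun A => ih _ hh (hh.le.trans hab) (fun i hi hia => hT i hi (hia.trans hh.le)) A)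
        (fun A => ih _ hN (hN.le.trans hab) (fun i hi hia => hT i hi (hia.trans hN.le)) A)).trans ?_
      have hsum := rpow_half_add_rpow_half_le hε (a + 2) (by omega)
      have hM := hT _ hN₁ hN.le
      have hle : (((a + 2) - (a + 2) / 2 : ℕ) : ℝ) ^ (1 + ε) ≤ ((a + 2 : ℕ) : ℝ) ^ (1 + ε) :=
        Real.rpow_le_rpow (Nat.cast_nonneg _) (by exact_mod_cast hN.le) (by linarith)
      generalize (a + 2) - (a + 2) / 2 = N at *
      have hN' : (0 : ℝ) < N := by exact_mod_cast hN₁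
      have hlevel : (T.Mat N : ℝ) * b / N ≤ K * b * ((a + 2 : ℕ) : ℝ) ^ (1 + ε) := by
        rw [div_le_iff₀ hN']
        calc (T.Mat N : ℝ) * b ≤ K * (N : ℝ) ^ (2 + ε) * b :=
              mul_le_mul_of_nonneg_right hM (Nat.cast_nonneg _)
          _ = K * b * (N : ℝ) ^ (1 + ε) * N := by
              rw [show 2 + ε = 1 + ε + 1 by ring, Real.rpow_add_one hN'.ne']
              ring
          _ ≤ _ := by gcongr
      have hKb : 0 ≤ K * b := by positivity
      have hD' : rankConstant ε * (1 - (2 / 3 : ℝ) ^ ε) = 11 := by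
        have := rpow_lt_one_of_two_thirds hε
        rw [rankConstant, div_mul_cancel₀]
        linarith
      calc _ ≤ rankConstant ε * (K * b) * ((2 / 3 : ℝ) ^ ε * ((a + 2 : ℕ) : ℝ) ^ (1 + ε)) +
            11 * (K * b * ((a + 2 : ℕ) : ℝ) ^ (1 + ε)) := by
              have := mul_le_mul_of_nonneg_left hsum
                (by positivity : 0 ≤ rankConstant ε * (K * b))
              linarith
        _ = _ := by
              rw [← hD']
              ring

variable {T}

/-- Elimination in a matrix with at most as many rows as columns. -/
theorem pivots_ops_le_of_regular {ε κ : ℝ} (hε : 0 < ε) (hT : T.Regular ε κ) {N a b : ℕ}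
    (hN : 1 ≤ N) (hab : a ≤ b) (haN : a ≤ N) (A : Table (Reg k)) :
    ((pivots T b a A).ops : ℝ) ≤ rankConstant ε * κ * (T.Mat N * ((a : ℝ) * b) / (N * N)) := by
  have hκ := hT.one_le
  have hD := le_rankConstant hε
  have hN' : (0 : ℝ) < N := by exact_mod_cast hN
  -- Regularity against the fixed size `N` gives one constant `K` for all smaller products; size 1
  -- shows that it is at least 1.
  have hK : ∀ i : ℕ, 1 ≤ i → i ≤ N →
      (T.Mat i : ℝ) ≤ κ * (T.Mat N / (N : ℝ) ^ (2 + ε)) * (i : ℝ) ^ (2 + ε) := fun i hi hiN => by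
    have hi' : (0 : ℝ) < i := by exact_mod_cast hi
    have := hT i N hi hiN
    rwa [div_le_iff₀ (by positivity)] at this
  have hK₁ : 1 ≤ κ * (T.Mat N / (N : ℝ) ^ (2 + ε)) := by
    have h := hK 1 le_rfl hN
    have h₁ : (1 : ℝ) ≤ T.Mat 1 := by exact_mod_cast T.sq_le_Mat 1
    simp only [Nat.cast_one, Real.one_rpow, mul_one] at h
    linarith
  refine (pivots_ops_le T hε hK₁ b a hab (fun i hi hia => hK i hi (hia.trans haN)) A).trans ?_
  -- Only one factor `a` is kept, so that `N ^ ε` cancels against `N ^ (2 + ε)` and leaves `N * N`.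
  have hpow : (a : ℝ) ^ (1 + ε) ≤ a * (N : ℝ) ^ ε := by
    rw [Real.rpow_add_of_nonneg a.cast_nonneg zero_le_one hε.le, Real.rpow_one]
    gcongr
  calc _ ≤ rankConstant ε * (κ * (T.Mat N / (N : ℝ) ^ (2 + ε))) * b * (a * (N : ℝ) ^ ε) := by
        gcongr
    _ = _ := by
        rw [Real.rpow_add hN', Real.rpow_two]
        field_simp

/-- The elimination bound is symmetric in the dimensions, and after the possible transposition the
smaller one is at most `N`. The factor 2 comes from `ν + 1 ≤ 2 ν`. -/
theorem rankComputation_ops_le {ε κ : ℝ} (hε : 0 < ε) (hT : T.Regular ε κ) {N m ν c : ℕ}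
    (hN : 1 ≤ N) (hν : 1 ≤ ν) (hc : c ≤ N) (A : Table (Reg k)) :
    ((rankComputation T (m * (ν + 1)) c A).ops : ℝ) ≤
      2 * rankConstant ε * κ * (T.Mat N * ((m : ℝ) * ν / N)) := by
  have hκ := hT.one_le
  have hD := le_rankConstant hε
  have hN' : (0 : ℝ) < N := by exact_mod_cast hN
  have hrows : ((m * (ν + 1) : ℕ) : ℝ) ≤ 2 * (m * ν) := by
    exact_mod_cast (by nlinarith : m * (ν + 1) ≤ 2 * (m * ν))
  have hc' : (c : ℝ) ≤ N := by exact_mod_cast hc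
  have hsize : (T.Mat N : ℝ) * (((m * (ν + 1) : ℕ) : ℝ) * c) / (N * N) ≤
      2 * (T.Mat N * ((m : ℝ) * ν / N)) := by
    calc _ ≤ (T.Mat N : ℝ) * (2 * (m * ν) * N) / (N * N) := by gcongr
      _ = _ := by field_simp
  have hbound : rankConstant ε * κ * ((T.Mat N : ℝ) * (((m * (ν + 1) : ℕ) : ℝ) * c) / (N * N)) ≤
      2 * rankConstant ε * κ * (T.Mat N * ((m : ℝ) * ν / N)) :=
    (mul_le_mul_of_nonneg_left hsize (by positivity)).trans_eq (by ring)
  rw [rankComputation]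
  split_ifs with h
  · exact (pivots_ops_le_of_regular hε hT hN h (h.trans hc) A).trans hbound
  · refine (pivots_ops_le_of_regular hε hT hN (not_le.mp h).le hc _).trans ?_
    rwa [mul_comm (c : ℝ)]

end Rank

end ObsTest

/-- The number of operations of the base field used by the local algebraic observability test. -/
theorem mainTheorem4 (ε κ : ℝ) (hε : 0 < ε) :
    ∃ C : ℝ, ∀ (k : Type*) [Field k] [DecidableEq k]
      (S : ObsTest.SeriesMultiplication k) (T : ObsTest.MatrixMultiplication k),
      S.Regular κ → T.Regular ε κ →
      ∀ (n l r m L ν : ℕ), 1 ≤ n → m ≤ n → 1 ≤ ν → ν ≤ n + l →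
      ∀ (sys : ObsTest.StateSpaceSystem k n l r m L) (z : ObsTest.Specialization k n l r),
        ((ObsTest.observabilityTest S T sys z ν).ops : ℝ) ≤
          C * ((S.M ν : ℝ) * ((T.Mat (n + l) : ℝ) + ((n : ℝ) + m) * L) +
            ((n : ℝ) + l + 1) * (T.Mat (n + l) : ℝ) * ((m : ℝ) * ν / ((n : ℝ) + l))) := by
  -- The summands stem from the main loop, the outputs and the ranks; cross terms of the product are
  -- nonnegative and are discarded at the end.
  refine ⟨304 * κ ^ 2 + 21 * κ + 2 * ObsTest.rankConstant ε * κ, ?_⟩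
  intro k _ _ S T hS hT n l r m L ν hn hm hν _ sys z
  have hκ := hS.one_le
  have hD := ObsTest.le_rankConstant hε
  have hN : 1 ≤ n + l := hn.trans (Nat.le_add_right n l)
  refine le_trans (ObsTest.Counted.ops_bind_le (ObsTest.solveVariational_ops_le T hS hn sys z ν)
    (ObsTest.Counted.ops_bind_le (ObsTest.evalOutput_ops_le T hS hn hm sys z ν _)
    (ObsTest.Counted.ops_bind_le (ObsTest.rankComputation_ops_le hε hT hN hν le_rfl _)
    (ObsTest.Counted.ops_bind_le (ObsTest.forFin_ops_le fun c =>
      ObsTest.rankComputation_ops_le hε hT hN hν (Nat.sub_le _ _) _)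
    (ObsTest.Counted.ops_pure_le _))))) ?_
  push_cast
  have h₁ : 304 * κ ^ 2 * ((S.M ν : ℝ) * (T.Mat (n + l) + n * L)) ≤
      304 * κ ^ 2 * ((S.M ν : ℝ) * (T.Mat (n + l) + (n + m) * L)) := by
    gcongr
    exact le_add_of_nonneg_right m.cast_nonneg
  set X : ℝ := (S.M ν : ℝ) * (T.Mat (n + l) + (n + m) * L)
  set Y : ℝ := (T.Mat (n + l) : ℝ) * ((m : ℝ) * ν / (n + l)) with hY
  have hX₀ : 0 ≤ X := by positivity
  have hY₀ : 0 ≤ ((n : ℝ) + l + 1) * Y := by positivity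
  have h₂ : 0 ≤ 2 * ObsTest.rankConstant ε * κ * X := by positivity
  have h₃ : 0 ≤ (304 * κ ^ 2 + 21 * κ) * (((n : ℝ) + l + 1) * Y) := by positivity
  rw [mul_assoc _ (T.Mat (n + l) : ℝ), ← hY]
  linarith
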